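/- Identify the plane with $\mathbb{C}$. Let $p,q\in\mathbb{R}$ with $|p|\neq|q|$, and let $\mathcal{A}(z)=pz+q\overline z$, so that $\mathcal{E}=\mathcal{A}(\{|z|=1\})$ is an ellipse with centre $0$ and semiaxes $|p+q|$ and $|p-q|$ along the coordinate axes. Let $f,g\in\mathbb{C}$ and $L>|f-g|$ be such that the ellipse $\mathcal{E}_0=\{z:|z-f|+|z-g|=L\}$ lies in the open unit disk, and let $\mathcal{E}'=\mathcal{A}(\mathcal{E}_0)$, an ellipse nested inside $\mathcal{E}$. Assume that the pair $(\mathcal{E},\mathcal{E}')$ admits Poncelet triangles, and let $\mathcal{T}$ be the family of all (non-degenerate) triangles inscribed in $\mathcal{E}$ whose three sidelines are tangent to $\mathcal{E}'$. Note that $|f|,|g|<1$. Put $$P_3=\frac{(g|f|^2+f|g|^2-f-g)\,p}{|f|^2|g|^2-1}+\frac{(|f|^2\overline g+\overline f|g|^2-\overline f-\overline g)\,q}{|f|^2|g|^2-1},$$ $$\Pi_3=\frac{(|g|^2-1)(\overline f g-1)(f\overline g-1)(|f|^2-1)\bigl(pq(fg+\overline{fg})-p^2-q^2\bigr)}{(|f|^2|g|^2-1)^2},$$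 $$D=2|f|^2|g|^2(p^4+q^4+p^2q^2)-2(fg+\overline{fg})\,pq\,(p^2+q^2)+2p^2q^2 ,$$ and, when $D\ne0$, $$P_5=\frac{\bigl(fg(f+g)p^2(\overline{fg}\,p-q)+\overline{fg}\,q^2(\overline f+\overline g)(fg\,q-p)\bigr)(p^2+q^2)}{D},\qquad \Pi_5=(p^2+q^2)\,(|fg|^2-1)\,\frac{\gamma_1}{\gamma_2},$$ where $$\gamma_2=4\bigl(|fg|^2p^4-(fg+\overline{fg})p^3q+(|fg|^2+1)p^2q^2-(fg+\overline{fg})pq^3+|fg|^2q^4\bigr)^2=D^2,$$ $$\gamma_1=c_0\,(p^8+q^8)+c_1\,(p^7q+pq^7)+c_2\,(p^6q^2+p^2q^6)+c_3\,(p^5q^3+p^3q^5)+c_4\,p^4q^4,$$ $$c_0=f^2g^2\overline f^2\overline g^2,\qquad c_1=-2fg\overline f\,\overline g\,(\overline f\,\overline g+fg),$$ $$c_2=2f^2g^2\overline f^2\overline g^2-\overline g^2\overline f f^2g-\overline g^2\overline f fg^2-\overline g\,\overline f^2f^2g-\overline g\,\overline f^2fg^2+\overline f^2\overline g^2+4f\overline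 f g\overline g+f^2g^2,$$ $$\begin{aligned}c_3={}&\overline g^3\overline f fg-2\overline g^2\overline f^2fg+fg\,\overline g\,\overline f^3+\overline g\,\overline f f^3g-2\overline g\,\overline f f^2g^2+\overline g\,\overline f fg^3+\overline g^2\overline f f+\overline g^2\overline f g\\&+\overline g\,\overline f^2f+\overline g\,\overline f^2g+\overline g f^2g+\overline g fg^2+\overline f f^2g+\overline f fg^2-2\overline f\,\overline g-2fg,\end{aligned}$$ $$\begin{aligned}c_4={}&3f^2g^2\overline f^2\overline g^2-3\overline g^2\overline f f^2g-3\overline g^2\overline f fg^2-3\overline g\,\overline f^2f^2g-3\overline g\,\overline f^2fg^2-\overline g^3\overline f-\overline g\,\overline f^3\\&+6f\overline f g\overline g-f^3g-fg^3-f\overline g-g\overline g-f\overline f-\overline f g+1.\end{aligned}$$ (i) The power of $P_3$ with respect to the circumcircle of every triangle of $\mathcal{T}$ equals $\Pi_3$. If moreover $pq\ne0$ (i.e. $\mathcal{E}$ is not a circle), then $P_3$ is the only point whose power with respect to the circumcircle is constant over $\mathcal{T}$. (ii) If $D\neq0$, then the power of $P_5$ with respect to the Euler (nine-point) circle of every triangle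 of $\mathcal{T}$ equals $\Pi_5$, and $P_5$ is the only point whose power with respect to the Euler circle is constant over $\mathcal{T}$. -/

import Mathlib

open scoped ComplexConjugate

noncomputable section

namespace PonceletPower

/-- The real-linear map `z ↦ p z + q conj z` of the plane `ℂ`. -/
def affineMap (p q : ℝ) (z : ℂ) : ℂ := p * z + q * conj z

/-- The ellipse with foci `f`, `g` and major axis of length `L`
(a genuine ellipse, possibly a circle, when `dist f g < L`). -/
def focalEllipse (f g : ℂ) (L : ℝ) : Set ℂ := {z | dist z f + dist z g = L}

/-- The triangle `T` is inscribed in `E` and circumscribes the ellipse `E'`: its vertices lie on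
`E`, and each of its three sidelines is tangent to `E'`, i.e. meets `E'` in exactly one point. -/
def IsInterscribed (E E' : Set ℂ) (T : Affine.Triangle ℝ ℂ) : Prop :=
  (∀ i, T.points i ∈ E) ∧
    ∀ i j, i ≠ j → ∃! x, x ∈ line[ℝ, T.points i, T.points j] ∧ x ∈ E'

/-- The outer ellipse: the image of the unit circle under `z ↦ p z + q conj z`. -/
def outerEllipse (p q : ℝ) : Set ℂ := affineMap p q '' Metric.sphere 0 1

/-- The inner ellipse: the image under `z ↦ p z + q conj z` of the ellipse with foci `f`, `g` and
major axis of length `L`. -/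
def innerEllipse (p q : ℝ) (f g : ℂ) (L : ℝ) : Set ℂ := affineMap p q '' focalEllipse f g L

/-- The family of all triangles inscribed in the outer ellipse and circumscribing the inner one. -/
def ponceletFamily (p q : ℝ) (f g : ℂ) (L : ℝ) : Set (Affine.Triangle ℝ ℂ) :=
  {T | IsInterscribed (outerEllipse p q) (innerEllipse p q f g L) T}

/-- The point `P₃`. -/
def P3 (f g : ℂ) (p q : ℝ) : ℂ :=
  (g * ‖f‖ ^ 2 + f * ‖g‖ ^ 2 - f - g) * p / (‖f‖ ^ 2 * ‖g‖ ^ 2 - 1) +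
    (‖f‖ ^ 2 * conj g + conj f * ‖g‖ ^ 2 - conj f - conj g) * q / (‖f‖ ^ 2 * ‖g‖ ^ 2 - 1)

/-- The invariant power `Π₃`. -/
def Pi3 (f g : ℂ) (p q : ℝ) : ℂ :=
  (‖g‖ ^ 2 - 1) * (conj f * g - 1) * (f * conj g - 1) * (‖f‖ ^ 2 - 1) *
    (p * q * (f * g + conj f * conj g) - p ^ 2 - q ^ 2) / (‖f‖ ^ 2 * ‖g‖ ^ 2 - 1) ^ 2

/-- The denominator of `P₅`. -/
def P5Denom (f g : ℂ) (p q : ℝ) : ℂ :=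
  2 * ‖f‖ ^ 2 * ‖g‖ ^ 2 * (p ^ 4 + q ^ 4 + p ^ 2 * q ^ 2) -
    2 * (f * g + conj f * conj g) * p * q * (p ^ 2 + q ^ 2) + 2 * p ^ 2 * q ^ 2

/-- The point `P₅`. -/
def P5 (f g : ℂ) (p q : ℝ) : ℂ :=
  (f * g * (f + g) * p ^ 2 * (conj f * conj g * p - q) +
      conj f * conj g * q ^ 2 * (conj f + conj g) * (f * g * q - p)) * (p ^ 2 + q ^ 2) /
    P5Denom f g p q

/-- The polynomial `γ₁`, where `F` and `G` stand for the conjugates of `f` and `g`. -/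
def gamma1 (f g F G p q : ℂ) : ℂ :=
  f ^ 2 * g ^ 2 * p ^ 8 * F ^ 2 * G ^ 2 - 2 * q * f * g * F * G * (F * G + f * g) * p ^ 7 +
  (2 * G ^ 2 * F ^ 2 * f ^ 2 * g ^ 2 - G ^ 2 * F * f ^ 2 * g - G ^ 2 * F * f * g ^ 2 -
    G * F ^ 2 * f ^ 2 * g - G * F ^ 2 * f * g ^ 2 + F ^ 2 * G ^ 2 + 4 * f * F * g * G +
    f ^ 2 * g ^ 2) * p ^ 6 * q ^ 2 +
  (G ^ 3 * F * f * g - 2 * G ^ 2 * F ^ 2 * f * g + f * g * G * F ^ 3 + G * F * f ^ 3 * g -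
    2 * G * F * f ^ 2 * g ^ 2 + G * F * f * g ^ 3 + G ^ 2 * F * f + G ^ 2 * F * g +
    G * F ^ 2 * f + G * F ^ 2 * g + G * f ^ 2 * g + G * f * g ^ 2 + F * f ^ 2 * g +
    F * f * g ^ 2 - 2 * F * G - 2 * f * g) * p ^ 5 * q ^ 3 +
  (3 * G ^ 2 * F ^ 2 * f ^ 2 * g ^ 2 - 3 * G ^ 2 * F * f ^ 2 * g - 3 * G ^ 2 * F * f * g ^ 2 -
    3 * G * F ^ 2 * f ^ 2 * g - 3 * G * F ^ 2 * f * g ^ 2 - G ^ 3 * F - G * F ^ 3 +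
    6 * f * F * g * G - f ^ 3 * g - f * g ^ 3 - f * G - g * G - f * F - F * g + 1) *
    q ^ 4 * p ^ 4 +
  (G ^ 3 * F * f * g - 2 * G ^ 2 * F ^ 2 * f * g + f * g * G * F ^ 3 + G * F * f ^ 3 * g -
    2 * G * F * f ^ 2 * g ^ 2 + G * F * f * g ^ 3 + G ^ 2 * F * f + G ^ 2 * F * g +
    G * F ^ 2 * f + G * F ^ 2 * g + G * f ^ 2 * g + G * f * g ^ 2 + F * f ^ 2 * g +
    F * f * g ^ 2 - 2 * F * G - 2 * f * g) * p ^ 3 * q ^ 5 +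
  (2 * G ^ 2 * F ^ 2 * f ^ 2 * g ^ 2 - G ^ 2 * F * f ^ 2 * g - G ^ 2 * F * f * g ^ 2 -
    G * F ^ 2 * f ^ 2 * g - G * F ^ 2 * f * g ^ 2 + F ^ 2 * G ^ 2 + 4 * f * F * g * G +
    f ^ 2 * g ^ 2) * p ^ 2 * q ^ 6 -
  2 * f * g * q ^ 7 * F * G * (F * G + f * g) * p + f ^ 2 * g ^ 2 * q ^ 8 * F ^ 2 * G ^ 2

/-- The polynomial `γ₂`, where `F` and `G` stand for the conjugates of `f` and `g`. -/
def gamma2 (f g F G p q : ℂ) : ℂ :=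
  4 * (f * F * g * G * p ^ 4 + (-(F * G) - f * g) * q * p ^ 3 +
    q ^ 2 * (f * F * g * G + 1) * p ^ 2 + (-(F * G) - f * g) * p * q ^ 3 +
    f * F * g * G * q ^ 4) ^ 2

/-- The invariant power `Π₅`. -/
def Pi5 (f g : ℂ) (p q : ℝ) : ℂ :=
  (p ^ 2 + q ^ 2) * (‖f * g‖ ^ 2 - 1) *
    (gamma1 f g (conj f) (conj g) p q / gamma2 f g (conj f) (conj g) p q)

end PonceletPower

end

namespace PonceletPower

/-! Pull the configuration back by `affineMap` to the unit circle. A line is tangent to an ellipse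
exactly when the product of its signed distances to the foci is the squared semiminor axis; for a
chord of the circle, `conj z = 1 / z` turns this into a polynomial relation between the endpoints.
Three such chords force the vertices to be the fibre of a degree-three Blaschke product over some
unimodular `l` (`blaschke_of_chords`), and also `L² - |f - g|² = (1 - |f|²)(1 - |g|²)`. Conversely
every unimodular `l` has a fibre of three distinct points (`exists_isBlaschkeFiber`), and under that
relation its chords are tangent. Hence the family is parametrized by the circle `|l| = 1`, and the
symmetric functions of the preimages of the vertices are affine in `l`.

Consequently, up to a nonzero constant factor, the power of `X` has the form `a + l * b + conj l *
c` for both circles (`circumsphere_power_eq`, `ninePointCircle_power_eq`), with `b` and `c` linear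
in `1, X, conj X`. Constancy means `b = c = 0`: two linear equations in `X` and `conj X`.
Eliminating `conj X` leaves `P3` or `P5` as the only candidate, and substituting it gives the power.
-/

/-! ### Focal ellipses and the tangency condition for chords of the unit circle. -/

theorem norm_focus_lt_one {f g : ℂ} {L : ℝ} (hL : dist f g < L)
    (h : focalEllipse f g L ⊆ Metric.ball 0 1) : ‖f‖ < 1 := by
  obtain ⟨d, hd, hfg⟩ : ∃ d : ℂ, ‖d‖ = 1 ∧ f - g = (‖f - g‖ : ℝ) * d := by
    by_cases h0 : f - g = 0
    · exact ⟨1, by simp, by simp [h0]⟩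
    · have : (‖f - g‖ : ℂ) ≠ 0 := by simpa using h0
      exact ⟨(f - g) / ‖f - g‖, by simp [h0], by field_simp⟩
  rw [dist_eq_norm] at hL
  set r := ‖f - g‖ with hr
  have hr0 : 0 ≤ r := norm_nonneg _
  have hL0 : 0 < L := hr0.trans_lt hL
  -- The endpoints of the major axis lie on the ellipse, and `f` is a convex combination of them
  -- with weights `(1 ± r / L) / 2`.
  have key : ∀ ε : ℝ, |ε| = 1 → (f + g) / 2 + (ε * (L / 2) : ℝ) * d ∈ Metric.ball (0 : ℂ) 1 := by
    intro ε hε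
    apply h
    have h1 : (f + g) / 2 + (ε * (L / 2) : ℝ) * d - f = ((ε * L - r) / 2 : ℝ) * d := by
      push_cast
      linear_combination (-1 / 2 : ℂ) * hfg
    have h2 : (f + g) / 2 + (ε * (L / 2) : ℝ) * d - g = ((ε * L + r) / 2 : ℝ) * d := by
      push_cast
      linear_combination (1 / 2 : ℂ) * hfg
    simp only [focalEllipse, Set.mem_ofPred_eq, dist_eq_norm, h1, h2, norm_mul, hd,
      Complex.norm_real, Real.norm_eq_abs, mul_one]
    rcases eq_or_eq_neg_of_abs_eq hε with rfl | rfl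
    · rw [abs_of_pos (by linarith), abs_of_pos (by linarith)]; ring
    · rw [abs_of_neg (by linarith), abs_of_neg (by linarith)]; ring
  have hrL := (div_le_one hL0).2 hL.le
  have hconv := (convex_ball (0 : ℂ) 1) (key 1 (by simp)) (key (-1) (by simp))
    (show 0 ≤ (1 + r / L) / 2 by positivity) (show 0 ≤ (1 - r / L) / 2 by linarith) (by ring)
  have hLc : (L : ℂ) ≠ 0 := by exact_mod_cast hL0.ne'
  have hf : ((1 + r / L) / 2 : ℝ) • ((f + g) / 2 + (1 * (L / 2) : ℝ) * d) +
      ((1 - r / L) / 2 : ℝ) • ((f + g) / 2 + (-1 * (L / 2) : ℝ) * d) = f := by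
    simp only [Complex.real_smul]
    push_cast
    field_simp
    linear_combination (-2 * L : ℂ) * hfg
  rw [hf] at hconv
  simpa using hconv

/-- A point lies on a focal ellipse exactly when it satisfies the polynomial equation of the
ellipse. -/
theorem mem_focalEllipse_iff {f g : ℂ} {L : ℝ} (hL : dist f g < L) (z : ℂ) :
    z ∈ focalEllipse f g L ↔
      4 * L ^ 2 * ‖z - f‖ ^ 2 = (L ^ 2 + ‖z - f‖ ^ 2 - ‖z - g‖ ^ 2) ^ 2 := by
  have h1 : ‖z - f‖ ≤ ‖z - g‖ + dist f g := by
    simpa [dist_eq_norm, norm_sub_rev f g] using dist_triangle z g f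
  have h2 : ‖z - g‖ ≤ ‖z - f‖ + dist f g := by
    simpa [dist_eq_norm] using dist_triangle z f g
  simp only [focalEllipse, Set.mem_ofPred_eq, dist_eq_norm z]
  have h3 : 0 ≤ ‖z - f‖ := norm_nonneg _
  have h4 : 0 ≤ ‖z - g‖ := norm_nonneg _
  have h5 : 0 ≤ dist f g := dist_nonneg
  generalize ‖z - f‖ = a at *
  generalize ‖z - g‖ = b at *
  constructor
  · intro h
    obtain rfl : b = L - a := by linarith
    ring
  · intro h
    -- Squaring introduces three spurious factors; the triangle inequality and `dist f g < L` keep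
    -- them nonzero.
    have h6 : ((L - a) ^ 2 - b ^ 2) * ((L + a) ^ 2 - b ^ 2) = 0 := by linear_combination -h
    have h7 : (a + b - L) * ((a - L - b) * ((L + a - b) * (L + a + b))) = 0 := by
      linear_combination h6
    rcases mul_eq_zero.1 h7 with h8 | h8
    · linarith
    · exfalso
      refine absurd h8 (mul_ne_zero (by linarith) (mul_ne_zero (by linarith) (by linarith)))

theorem existsUnique_quadratic_root_iff {a b c : ℝ} (ha : a ≠ 0) :
    (∃! t : ℝ, a * t ^ 2 + b * t + c = 0) ↔ b ^ 2 - 4 * a * c = 0 := by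
  constructor
  · rintro ⟨t, ht, hu⟩
    -- The other root, given by Vieta, must coincide with `t`.
    have h1 := hu (-b / a - t) (by
      have ht : a * t ^ 2 + b * t + c = 0 := ht
      simp only
      field_simp
      linear_combination a * ht)
    have h2 : b = -2 * a * t := by field_simp at h1; linarith
    have h3 : c = -a * t ^ 2 - b * t := by linarith
    rw [h3, h2]; ring
  · intro h
    refine ⟨-b / (2 * a), ?_, fun t ht => ?_⟩
    · field_simp
      linear_combination (-1 : ℝ) * h
    · have : (2 * a * t + b) ^ 2 = 0 := by linear_combination 4 * a * ht + h
      have := pow_eq_zero_iff (two_ne_zero) |>.1 this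
      field_simp
      linarith

/-- The tangency condition of a line, given by a point and a direction, to a focal ellipse. -/
theorem existsUnique_lineMap_mem_focalEllipse_iff {f g : ℂ} {L : ℝ} (hL : dist f g < L)
    {z e : ℂ} (he : e ≠ 0) :
    (∃! t : ℝ, z + t * e ∈ focalEllipse f g L) ↔
      Complex.normSq e * (L ^ 2 - Complex.normSq (f - g)) =
        4 * (conj e * (z - f)).im * (conj e * (z - g)).im := by
  have hd : Complex.normSq (f - g) < L ^ 2 := by
    rw [Complex.normSq_eq_norm_sq, ← dist_eq_norm]
    exact pow_lt_pow_left₀ hL dist_nonneg two_ne_zero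
  have hL0 : L ≠ 0 := (dist_nonneg.trans_lt hL).ne'
  have he2 : 0 < Complex.normSq e := Complex.normSq_pos.2 he
  have hcs : (e.re * (g - f).re + e.im * (g - f).im) ^ 2 ≤
      Complex.normSq e * Complex.normSq (f - g) := by
    simp only [Complex.normSq_apply, Complex.sub_re, Complex.sub_im]
    nlinarith [sq_nonneg (e.re * (g.im - f.im) - e.im * (g.re - f.re))]
  set A : ℝ := 4 * L ^ 2 * Complex.normSq e - (2 * (e.re * (g - f).re + e.im * (g - f).im)) ^ 2
    with hA
  -- The leading coefficient is positive by Cauchy–Schwarz, as `|f - g| < L`; each line therefore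
  -- gives a genuine quadratic, and tangency is a vanishing discriminant.
  have hA0 : A ≠ 0 := by
    have : Complex.normSq e * Complex.normSq (f - g) < Complex.normSq e * L ^ 2 :=
      mul_lt_mul_of_pos_left hd he2
    have : 0 < A := by rw [hA]; nlinarith
    exact this.ne'
  set B : ℝ := 8 * L ^ 2 * (e.re * (z - f).re + e.im * (z - f).im) -
    4 * (L ^ 2 + Complex.normSq (z - f) - Complex.normSq (z - g)) *
      (e.re * (g - f).re + e.im * (g - f).im) with hB
  set C : ℝ := 4 * L ^ 2 * Complex.normSq (z - f) -
    (L ^ 2 + Complex.normSq (z - f) - Complex.normSq (z - g)) ^ 2 with hC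
  have hQ : ∀ t : ℝ, z + t * e ∈ focalEllipse f g L ↔ A * t ^ 2 + B * t + C = 0 := by
    intro t
    rw [mem_focalEllipse_iff hL, ← sub_eq_zero]
    simp only [← Complex.normSq_eq_norm_sq]
    refine Eq.congr ?_ rfl
    simp only [hA, hB, hC, Complex.normSq_apply, Complex.sub_re, Complex.sub_im, Complex.add_re,
      Complex.add_im, Complex.mul_re, Complex.mul_im, Complex.ofReal_re, Complex.ofReal_im]
    ring
  simp only [hQ]
  rw [existsUnique_quadratic_root_iff hA0]
  have hdisc : B ^ 2 - 4 * A * C = 16 * L ^ 2 * (L ^ 2 - Complex.normSq (f - g)) *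
      (Complex.normSq e * (L ^ 2 - Complex.normSq (f - g)) -
        4 * (conj e * (z - f)).im * (conj e * (z - g)).im) := by
    simp only [hA, hB, hC, Complex.normSq_apply, Complex.sub_re, Complex.sub_im,
      Complex.mul_im, Complex.conj_re, Complex.conj_im]
    ring
  rw [hdisc, mul_eq_zero, sub_eq_zero, or_iff_right]
  exact mul_ne_zero (by positivity) (by linarith)

theorem affineMap_injective {p q : ℝ} (hpq : |p| ≠ |q|) : Function.Injective (affineMap p q) := by
  intro z w h
  have h1 : (p : ℂ) * (z - w) + q * conj (z - w) = 0 := by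
    simp only [affineMap] at h
    simp only [map_sub]
    linear_combination h
  have h2 : (p : ℂ) * conj (z - w) + q * (z - w) = 0 := by
    simpa using congrArg conj h1
  have h3 : ((p : ℂ) ^ 2 - q ^ 2) * (z - w) = 0 := by linear_combination p * h1 - q * h2
  rcases mul_eq_zero.1 h3 with h4 | h4
  · refine absurd ?_ hpq
    rw [← sq_eq_sq_iff_abs_eq_abs]
    exact_mod_cast sub_eq_zero.1 h4
  · exact sub_eq_zero.1 h4

theorem affineMap_lineMap (p q : ℝ) (z w : ℂ) (t : ℝ) :
    AffineMap.lineMap (affineMap p q z) (affineMap p q w) t =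
      affineMap p q (z + t * (w - z)) := by
  simp only [AffineMap.lineMap_apply, affineMap, vsub_eq_sub, vadd_eq_add, Complex.real_smul,
    map_add, map_mul, map_sub, Complex.conj_ofReal]
  ring

/-- `(conj (w - z) * (z - h)).im` is, up to sign, `|w - z|` times the distance from `h` to the
chord, whose equation on the unit circle is `h + z * w * conj h = z + w`. -/
theorem chord_mul_chord {z w f g : ℂ} (hz : z * conj z = 1) (hw : w * conj w = 1) :
    z * w * (4 * (conj (w - z) * (z - f)).im * (conj (w - z) * (z - g)).im : ℝ) =
      Complex.normSq (w - z) *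
        ((f + z * w * conj f - z - w) * (g + z * w * conj g - z - w)) := by
  have him : ∀ x : ℂ, ((x.im : ℝ) : ℂ) = -(x - conj x) * Complex.I / 2 := by
    intro x
    rw [Complex.sub_conj]
    push_cast
    linear_combination (x.im : ℂ) * Complex.I_sq
  have hmain : ∀ h : ℂ, z * w * (conj (w - z) * (z - h) - conj (conj (w - z) * (z - h))) =
      (w - z) * (h + z * w * conj h - z - w) := by
    intro h
    simp only [map_mul, map_sub, Complex.conj_conj]
    linear_combination z * (z - h) * hw - (w * (z - h) + (w - z) * w) * hz
  have hc : z * w * conj (w - z) = -(w - z) := by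
    simp only [map_sub]
    linear_combination z * hw - w * hz
  have hzw : z * w ≠ 0 := mul_ne_zero (left_ne_zero_of_mul_eq_one hz) (left_ne_zero_of_mul_eq_one hw)
  apply mul_left_cancel₀ hzw
  push_cast
  rw [him, him, Complex.normSq_eq_conj_mul_self]
  have h1 := congrArg₂ (· * ·) (hmain f) (hmain g)
  linear_combination (-(w - z) * (f + z * w * conj f - z - w) * (g + z * w * conj g - z - w)) * hc -
    h1 + (z * w) ^ 2 * (conj (w - z) * (z - f) - conj (conj (w - z) * (z - f))) *
      (conj (w - z) * (z - g) - conj (conj (w - z) * (z - g))) * Complex.I_sq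

/-- The chord joining two points of the unit circle is mapped to a tangent line of the inner
ellipse exactly when the product of the signed distances of the foci to the chord is the square of
the semiminor axis. -/
theorem existsUnique_mem_line_innerEllipse_iff {p q : ℝ} (hpq : |p| ≠ |q|) {f g : ℂ} {L : ℝ}
    (hL : dist f g < L) {z w : ℂ} (hz : z * conj z = 1) (hw : w * conj w = 1) (hzw : z ≠ w) :
    (∃! x, x ∈ line[ℝ, affineMap p q z, affineMap p q w] ∧ x ∈ innerEllipse p q f g L) ↔
      (f + z * w * conj f - z - w) * (g + z * w * conj g - z - w) =
        ((L : ℂ) ^ 2 - (f - g) * conj (f - g)) * (z * w) := by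
  have hinj := affineMap_injective hpq
  have he : w - z ≠ 0 := sub_ne_zero.2 hzw.symm
  have h1 : (∃! x, x ∈ line[ℝ, affineMap p q z, affineMap p q w] ∧ x ∈ innerEllipse p q f g L) ↔
      ∃! t : ℝ, z + t * (w - z) ∈ focalEllipse f g L := by
    have hmem : ∀ t : ℝ, affineMap p q (z + t * (w - z)) ∈ innerEllipse p q f g L ↔
        z + t * (w - z) ∈ focalEllipse f g L := fun t => hinj.mem_set_image
    constructor
    · rintro ⟨x, ⟨hx, hx'⟩, hu⟩
      obtain ⟨t, rfl⟩ := mem_affineSpan_pair_iff_exists_lineMap_eq.1 hx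
      rw [affineMap_lineMap] at hx' hu
      refine ⟨t, (hmem t).1 hx', fun t' ht' => ?_⟩
      have := hinj (hu (affineMap p q (z + t' * (w - z)))
        ⟨by rw [← affineMap_lineMap]; exact AffineMap.lineMap_mem_affineSpan_pair _ _ _,
          (hmem t').2 ht'⟩)
      simpa [he] using this
    · rintro ⟨t, ht, hu⟩
      refine ⟨affineMap p q (z + t * (w - z)),
        ⟨by rw [← affineMap_lineMap]; exact AffineMap.lineMap_mem_affineSpan_pair _ _ _,
          (hmem t).2 ht⟩, ?_⟩
      rintro x ⟨hx, hx'⟩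
      obtain ⟨t', rfl⟩ := mem_affineSpan_pair_iff_exists_lineMap_eq.1 hx
      rw [affineMap_lineMap] at hx' ⊢
      rw [hu t' ((hmem t').1 hx')]
  have hzw0 : z * w ≠ 0 :=
    mul_ne_zero (left_ne_zero_of_mul_eq_one hz) (left_ne_zero_of_mul_eq_one hw)
  have hn : (Complex.normSq (w - z) : ℂ) ≠ 0 := by simpa using he
  have h2 := chord_mul_chord (f := f) (g := g) hz hw
  rw [h1, existsUnique_lineMap_mem_focalEllipse_iff hL he, ← Complex.ofReal_inj,
    ← mul_right_inj' hzw0, h2, Complex.mul_conj]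
  push_cast
  constructor
  · intro h
    apply mul_left_cancel₀ hn
    linear_combination -h
  · intro h
    rw [h]
    ring

/-! ### Poncelet triangles as fibres of a Blaschke product. -/

/-- A polynomial of degree at most two that vanishes at three distinct points is zero. -/
theorem quadratic_coeffs_eq_zero {a b c x y z : ℂ} (hxy : x ≠ y) (hxz : x ≠ z) (hyz : y ≠ z)
    (hx : a * x ^ 2 + b * x + c = 0) (hy : a * y ^ 2 + b * y + c = 0)
    (hz : a * z ^ 2 + b * z + c = 0) : a = 0 ∧ b = 0 ∧ c = 0 := by
  have h1 : a * (x + y) + b = 0 := by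
    apply mul_left_cancel₀ (sub_ne_zero.2 hxy)
    linear_combination hx - hy
  have h2 : a * (x + z) + b = 0 := by
    apply mul_left_cancel₀ (sub_ne_zero.2 hxz)
    linear_combination hx - hz
  have ha : a = 0 := by
    apply mul_left_cancel₀ (sub_ne_zero.2 hyz)
    linear_combination h1 - h2
  have hb : b = 0 := by simpa [ha] using h1
  exact ⟨ha, hb, by simpa [ha, hb] using hx⟩

/-- The three points `z i` of the unit circle are the preimages of `l` under the Blaschke product
`z (z - f) (z - g) / ((1 - conj f z) (1 - conj g z))`. -/
structure IsBlaschkeFiber (f g l : ℂ) (z : Fin 3 → ℂ) : Prop where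
  norm_eq : ∀ i, ‖z i‖ = 1
  injective : Function.Injective z
  sum : z 0 + z 1 + z 2 = f + g + l * (conj f * conj g)
  sum_mul : z 0 * z 1 + z 0 * z 2 + z 1 * z 2 = f * g + l * (conj f + conj g)
  prod : z 0 * z 1 * z 2 = l

theorem IsBlaschkeFiber.norm_param {f g l : ℂ} {z : Fin 3 → ℂ} (h : IsBlaschkeFiber f g l z) :
    ‖l‖ = 1 := by
  rw [← h.prod, norm_mul, norm_mul, h.norm_eq, h.norm_eq, h.norm_eq]
  norm_num

/-- The tangency relation for two of the vertices, as a quadratic equation in the second one. -/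
theorem sum_prod_of_chords {f g F G κ u v w : ℂ} (hvw : v ≠ w)
    (hv : (f + u * v * F - u - v) * (g + u * v * G - u - v) = κ * (u * v))
    (hw : (f + u * w * F - u - w) * (g + u * w * G - u - w) = κ * (u * w)) :
    (v + w) * ((1 - F * u) * (1 - G * u)) =
        (u - f) * (u * G - 1) + (u - g) * (u * F - 1) + κ * u ∧
      u * v * w * ((1 - F * u) * (1 - G * u)) = u * (u - f) * (u - g) := by
  have h1 : (v + w) * ((1 - F * u) * (1 - G * u)) =
        (u - f) * (u * G - 1) + (u - g) * (u * F - 1) + κ * u := by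
    -- Vieta for the quadratic with roots `v` and `w`: this is the sum of the roots, and the product
    -- follows from it.
    apply mul_left_cancel₀ (sub_ne_zero.2 hvw)
    linear_combination hv - hw
  exact ⟨h1, by linear_combination u * v * h1 - u * hv⟩

/-- Each vertex is a root of the cubic `u (u - f) (u - g) - l (1 - conj f u) (1 - conj g u)`. It and
`∏ (u - z i)` are monic with constant term `-l`, so their difference is a quadratic with three
zeros, and the coefficients agree. The sum relation at `z 0` then determines `κ`. -/
theorem blaschke_of_chords {f g κ : ℂ} {z : Fin 3 → ℂ}
    (hz : ∀ i, ‖z i‖ = 1) (hinj : Function.Injective z)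
    (h : ∀ i j, i ≠ j → (f + z i * z j * conj f - z i - z j) * (g + z i * z j * conj g - z i - z j) =
      κ * (z i * z j)) :
    IsBlaschkeFiber f g (z 0 * z 1 * z 2) z ∧ κ = (1 - f * conj f) * (1 - g * conj g) := by
  have h01 : z 0 ≠ z 1 := hinj.ne (by decide)
  have h02 : z 0 ≠ z 2 := hinj.ne (by decide)
  have h12 : z 1 ≠ z 2 := hinj.ne (by decide)
  obtain ⟨a0, b0⟩ := sum_prod_of_chords h12 (h 0 1 (by decide)) (h 0 2 (by decide))
  obtain ⟨-, b1⟩ := sum_prod_of_chords h02 (h 1 0 (by decide)) (h 1 2 (by decide))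
  obtain ⟨-, b2⟩ := sum_prod_of_chords h01 (h 2 0 (by decide)) (h 2 1 (by decide))
  set l := z 0 * z 1 * z 2 with hl
  have key : ∀ u, (u - z 0) * (u - z 1) * (u - z 2) = 0 →
      l * ((1 - conj f * u) * (1 - conj g * u)) = u * (u - f) * (u - g) →
      (z 0 + z 1 + z 2 - (f + g + l * (conj f * conj g))) * u ^ 2 +
        -(z 0 * z 1 + z 0 * z 2 + z 1 * z 2 - (f * g + l * (conj f + conj g))) * u + 0 = 0 := by
    intro u h1 h2
    linear_combination -h1 - h2 - hl
  obtain ⟨h1, h2, -⟩ := quadratic_coeffs_eq_zero h01 h02 h12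
    (key _ (by ring) (by linear_combination b0)) (key _ (by ring) (by linear_combination b1))
    (key _ (by ring) (by linear_combination b2))
  have h0 : z 0 ≠ 0 := norm_ne_zero_iff.1 (by rw [hz]; exact one_ne_zero)
  refine ⟨⟨hz, hinj, sub_eq_zero.1 h1, sub_eq_zero.1 (neg_eq_zero.1 h2), rfl⟩, ?_⟩
  apply mul_left_cancel₀ h0
  linear_combination -a0 + (1 - conj f * z 0) * (1 - conj g * z 0) * h1 + conj f * conj g * b0

/-- Converse of `blaschke_of_chords`: the Vieta computation run backwards from the cubic. -/
theorem IsBlaschkeFiber.chord {f g l : ℂ} {z : Fin 3 → ℂ}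
    (h : IsBlaschkeFiber f g l z) {i j : Fin 3} (hij : i ≠ j) :
    (f + z i * z j * conj f - z i - z j) * (g + z i * z j * conj g - z i - z j) =
      (1 - f * conj f) * (1 - g * conj g) * (z i * z j) := by
  have key : ∀ u v w : ℂ, u ≠ 0 → u + v + w = f + g + l * (conj f * conj g) →
      u * v + u * w + v * w = f * g + l * (conj f + conj g) → u * v * w = l →
      (f + u * v * conj f - u - v) * (g + u * v * conj g - u - v) =
        (1 - f * conj f) * (1 - g * conj g) * (u * v) := by
    intro u v w hu h1 h2 h3
    have hb : l * ((1 - conj f * u) * (1 - conj g * u)) = u * (u - f) * (u - g) := by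
      linear_combination -u ^ 2 * h1 + u * h2 - h3
    apply mul_left_cancel₀ hu
    have hsum : (v + w) * ((1 - conj f * u) * (1 - conj g * u)) =
        (u - f) * (u * conj g - 1) + (u - g) * (u * conj f - 1) +
          (1 - f * conj f) * (1 - g * conj g) * u := by
      linear_combination (1 - conj f * u) * (1 - conj g * u) * h1 + conj f * conj g * hb
    linear_combination u * v * hsum - hb - (1 - conj f * u) * (1 - conj g * u) * h3
  have hz : ∀ i, z i ≠ 0 := fun i => norm_ne_zero_iff.1 (by rw [h.norm_eq]; exact one_ne_zero)
  have h1 := h.sum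
  have h2 := h.sum_mul
  have h3 := h.prod
  obtain ⟨k, hk⟩ : ∃ k, z i + z j + z k = z 0 + z 1 + z 2 ∧
      z i * z j + z i * z k + z j * z k = z 0 * z 1 + z 0 * z 2 + z 1 * z 2 ∧
      z i * z j * z k = z 0 * z 1 * z 2 := by
    fin_cases i <;> fin_cases j <;>
      simp only [Fin.mk_one, Fin.zero_eta, Fin.reduceFinMk] at hij ⊢ <;>
      first
      | exact absurd rfl hij
      | exact ⟨0, by ring1, by ring1, by ring1⟩
      | exact ⟨1, by ring1, by ring1, by ring1⟩
      | exact ⟨2, by ring1, by ring1, by ring1⟩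
  exact key _ _ (z k) (hz i) (hk.1.trans h1) (hk.2.1.trans h2) (hk.2.2.trans h3)

theorem normSq_one_sub_conj_mul (f u : ℂ) :
    Complex.normSq (1 - conj f * u) =
      Complex.normSq (u - f) + (1 - Complex.normSq u) * (1 - Complex.normSq f) := by
  simp only [Complex.normSq_apply, Complex.sub_re, Complex.sub_im, Complex.mul_re, Complex.mul_im,
    Complex.one_re, Complex.one_im, Complex.conj_re, Complex.conj_im]
  ring

theorem normSq_lt_one {f : ℂ} (hf : ‖f‖ < 1) : Complex.normSq f < 1 := by
  rw [Complex.normSq_eq_norm_sq]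
  exact pow_lt_one₀ (norm_nonneg _) hf two_ne_zero

/-- The Blaschke product has modulus below 1 inside the disk and above 1 outside; the cases `x < 1`
and `x > 1` express this without denominators. -/
theorem norm_eq_one_of_blaschke {f g l u : ℂ} (hf : ‖f‖ < 1) (hg : ‖g‖ < 1) (hl : ‖l‖ = 1)
    (h : l * ((1 - conj f * u) * (1 - conj g * u)) = u * (u - f) * (u - g)) : ‖u‖ = 1 := by
  have h1 := congrArg Complex.normSq h
  have hl' : Complex.normSq l = 1 := by rw [Complex.normSq_eq_norm_sq, hl, one_pow]
  simp only [map_mul, hl', normSq_one_sub_conj_mul, one_mul] at h1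
  have hf' := normSq_lt_one hf
  have hg' := normSq_lt_one hg
  have ha := Complex.normSq_nonneg (u - f)
  have hb := Complex.normSq_nonneg (u - g)
  have hu := Complex.normSq_nonneg u
  have hc := Complex.normSq_nonneg (1 - conj f * u)
  have hd := Complex.normSq_nonneg (1 - conj g * u)
  rw [normSq_one_sub_conj_mul] at hc hd
  suffices Complex.normSq u = 1 by
    rw [Complex.normSq_eq_norm_sq] at this
    exact (pow_eq_one_iff_of_nonneg (norm_nonneg _) two_ne_zero).1 this
  generalize Complex.normSq u = x at *
  generalize Complex.normSq (u - f) = a at *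
  generalize Complex.normSq (u - g) = b at *
  generalize Complex.normSq f = r at *
  generalize Complex.normSq g = s at *
  have h2 : (1 - x) * (a * b + a * (1 - s) + b * (1 - r) + (1 - x) * ((1 - r) * (1 - s))) = 0 := by
    linear_combination h1
  have hr : 0 < 1 - r := by linarith
  have hs : 0 < 1 - s := by linarith
  rcases lt_trichotomy x 1 with hx | hx | hx
  · have hx' : 0 < 1 - x := by linarith
    exact absurd h2 (by positivity)
  · exact hx
  · have hx' : 0 < x - 1 := by linarith
    have ha' : 0 < a := by nlinarith [mul_pos hx' hr]
    have hb' : 0 < b := by nlinarith [mul_pos hx' hs]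
    have hca : a + (1 - x) * (1 - r) ≤ a := by nlinarith [mul_pos hx' hr]
    have hdb : b + (1 - x) * (1 - s) ≤ b := by nlinarith [mul_pos hx' hs]
    have h3 := mul_le_mul hca hdb hd ha
    nlinarith [mul_pos hx' (mul_pos ha' hb')]

/-- Used to show that the cubic has simple roots. On the unit circle the Blaschke product `B`
satisfies `u B' / B = 1 + (1 - |f|²) / |1 - conj f u|² + (1 - |g|²) / |1 - conj g u|² > 0`; `hpos`
is this inequality with denominators cleared. -/
theorem blaschke_deriv_ne_zero {f g l u : ℂ} (hf : ‖f‖ < 1) (hg : ‖g‖ < 1) (hu : ‖u‖ = 1)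
    (h : l * ((1 - conj f * u) * (1 - conj g * u)) = u * (u - f) * (u - g)) :
    3 * u ^ 2 - 2 * u * (f + g + l * (conj f * conj g)) + (f * g + l * (conj f + conj g)) ≠ 0 := by
  intro h'
  have huu : u * conj u = 1 := by rw [Complex.mul_conj', hu]; norm_num
  have hu0 : u ≠ 0 := left_ne_zero_of_mul_eq_one huu
  have hc : ∀ f : ℂ, u - f = u * conj (1 - conj f * u) := by
    intro f
    simp only [map_sub, map_mul, map_one, Complex.conj_conj]
    linear_combination f * huu
  have hpos : 0 < Complex.normSq (1 - conj f * u) * Complex.normSq (1 - conj g * u) +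
      (1 - Complex.normSq f) * Complex.normSq (1 - conj g * u) +
      (1 - Complex.normSq g) * Complex.normSq (1 - conj f * u) := by
    have hne : ∀ f : ℂ, ‖f‖ < 1 → 0 < Complex.normSq (1 - conj f * u) := by
      intro f hf
      rw [Complex.normSq_pos]
      intro h
      have : ‖conj f * u‖ = 1 := by rw [← sub_eq_zero.1 h, norm_one]
      rw [norm_mul, RCLike.norm_conj, hu, mul_one] at this
      exact hf.ne this
    have := normSq_lt_one hf
    have := normSq_lt_one hg
    have := hne f hf
    have := hne g hg
    have : 0 < 1 - Complex.normSq f := by linarith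
    have : 0 < 1 - Complex.normSq g := by linarith
    positivity
  refine hpos.ne' ?_
  rw [← Complex.ofReal_inj]
  push_cast
  simp only [← Complex.mul_conj]
  apply mul_left_cancel₀ (pow_ne_zero 2 hu0)
  have h1 := hc f
  have h2 := hc g
  set a := 1 - conj f * u with ha
  set b := 1 - conj g * u with hb
  have h3 : a * b * (u - f) * (u - g) + (1 - f * conj f) * u * b * (u - g) +
      (1 - g * conj g) * u * a * (u - f) = 0 := by
    rw [ha, hb] at *
    linear_combination (1 - conj f * u) * (1 - conj g * u) * h' -
      (conj f * (1 - conj g * u) + conj g * (1 - conj f * u)) * h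
  rw [h1, h2] at h3
  linear_combination h3

theorem exists_isBlaschkeFiber {f g l : ℂ} (hf : ‖f‖ < 1) (hg : ‖g‖ < 1) (hl : ‖l‖ = 1) :
    ∃ z, IsBlaschkeFiber f g l z := by
  let P : Cubic ℂ := ⟨1, -(f + g + l * (conj f * conj g)), f * g + l * (conj f + conj g), -l⟩
  have ha : P.a ≠ 0 := one_ne_zero
  obtain ⟨x, y, w, hr⟩ := (Cubic.splits_iff_roots_eq_three (φ := RingHom.id ℂ) ha).1
    (IsAlgClosed.splits _)
  have h1 : x + y + w = f + g + l * (conj f * conj g) := by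
    have := Cubic.b_eq_three_roots ha hr
    simp only [P, RingHom.id_apply] at this
    linear_combination this
  have h2 : x * y + x * w + y * w = f * g + l * (conj f + conj g) := by
    have := Cubic.c_eq_three_roots ha hr
    simp only [P, RingHom.id_apply] at this
    linear_combination -this
  have h3 : x * y * w = l := by
    have := Cubic.d_eq_three_roots ha hr
    simp only [P, RingHom.id_apply] at this
    linear_combination this
  have key : ∀ u, (u - x) * (u - y) * (u - w) = 0 →
      l * ((1 - conj f * u) * (1 - conj g * u)) = u * (u - f) * (u - g) := by
    intro u hu
    linear_combination -hu - u ^ 2 * h1 + u * h2 - h3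
  have kx := key x (by ring)
  have ky := key y (by ring)
  have kw := key w (by ring)
  have nx := norm_eq_one_of_blaschke hf hg hl kx
  have ny := norm_eq_one_of_blaschke hf hg hl ky
  have nw := norm_eq_one_of_blaschke hf hg hl kw
  have hxy : x ≠ y := by
    intro e
    refine blaschke_deriv_ne_zero hf hg nx kx ?_
    rw [← e] at h1 h2
    linear_combination 2 * x * h1 - h2
  have hxw : x ≠ w := by
    intro e
    refine blaschke_deriv_ne_zero hf hg nx kx ?_
    rw [← e] at h1 h2
    linear_combination 2 * x * h1 - h2
  have hyw : y ≠ w := by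
    intro e
    refine blaschke_deriv_ne_zero hf hg ny ky ?_
    rw [← e] at h1 h2
    linear_combination 2 * y * h1 - h2
  refine ⟨![x, y, w], ?_, ?_, h1, h2, h3⟩
  · intro i
    fin_cases i
    exacts [nx, ny, nw]
  · intro i j hij
    fin_cases i <;> fin_cases j <;> simp_all

/-- Three distinct points of the unit circle form a triangle, as do their images under an
invertible affine map. -/
theorem affineIndependent_affineMap {p q : ℝ} (hpq : |p| ≠ |q|) {z : Fin 3 → ℂ}
    (hz : ∀ i, ‖z i‖ = 1) (hinj : Function.Injective z) :
    AffineIndependent ℝ fun i => affineMap p q (z i) := by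
  have hcos : EuclideanGeometry.Cospherical (Set.range z) :=
    ⟨0, 1, by rintro _ ⟨i, rfl⟩; simpa using hz i⟩
  have h := hcos.affineIndependent subset_rfl hinj
  let A : ℂ →ₗ[ℝ] ℂ :=
    { toFun := affineMap p q
      map_add' := fun x y => by simp only [affineMap, map_add]; ring
      map_smul' := fun c x => by
        simp only [affineMap, Complex.real_smul, map_mul, Complex.conj_ofReal, RingHom.id_apply]
        ring }
  exact h.map' A.toAffineMap (affineMap_injective hpq)

theorem exists_isBlaschkeFiber_of_mem {p q : ℝ} (hpq : |p| ≠ |q|) {f g : ℂ} {L : ℝ}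
    (hL : dist f g < L) {T : Affine.Triangle ℝ ℂ} (hT : T ∈ ponceletFamily p q f g L) :
    (∃ l z, IsBlaschkeFiber f g l z ∧ ∀ i, T.points i = affineMap p q (z i)) ∧
      (L : ℂ) ^ 2 - (f - g) * conj (f - g) = (1 - f * conj f) * (1 - g * conj g) := by
  obtain ⟨hv, ht⟩ := hT
  choose z hz hzT using hv
  have hz' : ∀ i, ‖z i‖ = 1 := fun i => by simpa using hz i
  have hz1 : ∀ i, z i * conj (z i) = 1 := fun i => by rw [Complex.mul_conj', hz' i]; norm_num
  have hinj : Function.Injective z := by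
    intro i j hij
    apply T.independent.injective
    rw [← hzT, ← hzT, hij]
  obtain ⟨h1, h2⟩ := blaschke_of_chords (f := f) (g := g) hz' hinj fun i j hij => by
    have := ht i j hij
    rw [← hzT, ← hzT] at this
    exact (existsUnique_mem_line_innerEllipse_iff hpq hL (hz1 i) (hz1 j) (hinj.ne hij)).1 this
  exact ⟨⟨_, z, h1, fun i => (hzT i).symm⟩, h2⟩

/-- Poncelet's porism: one triangle fixes `L` in terms of `f` and `g`, and then every unimodular
parameter yields a triangle. -/
theorem exists_mem_of_norm_eq_one {p q : ℝ} (hpq : |p| ≠ |q|) {f g : ℂ} {L : ℝ}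
    (hL : dist f g < L) (hf : ‖f‖ < 1) (hg : ‖g‖ < 1)
    (hfam : (ponceletFamily p q f g L).Nonempty) {l : ℂ} (hl : ‖l‖ = 1) :
    ∃ T ∈ ponceletFamily p q f g L, ∃ z, IsBlaschkeFiber f g l z ∧
      ∀ i, T.points i = affineMap p q (z i) := by
  obtain ⟨T₀, hT₀⟩ := hfam
  have hκ := (exists_isBlaschkeFiber_of_mem hpq hL hT₀).2
  obtain ⟨z, hz⟩ := exists_isBlaschkeFiber hf hg hl
  have hz1 : ∀ i, z i * conj (z i) = 1 := fun i => by
    rw [Complex.mul_conj', hz.norm_eq i]; norm_num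
  refine ⟨⟨_, affineIndependent_affineMap hpq hz.norm_eq hz.injective⟩,
    ⟨fun i => ⟨z i, by simpa using hz.norm_eq i, rfl⟩, fun i j hij => ?_⟩, z, hz, fun i => rfl⟩
  refine (existsUnique_mem_line_innerEllipse_iff hpq hL (hz1 i) (hz1 j)
    (hz.injective.ne hij)).2 ?_
  rw [hκ]
  exact hz.chord hij

/-! ### Powers of a point as functions of the parameter `l`. -/

/-- The coefficients of the circle through the images of three points of the unit circle. -/
theorem circle_coeffs {P Q a b c x y z : ℂ} (hxy : x ≠ y) (hxz : x ≠ z) (hyz : y ≠ z)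
    (hl : x * y * z ≠ 0)
    (h : ∀ u ∈ ({x, y, z} : Set ℂ), P * Q * u ^ 4 - a * u ^ 3 + c * u ^ 2 - b * u + P * Q = 0) :
    a * (x * y * z) = P * Q * ((x + y + z) * (x * y * z) + 1) ∧
      b * (x * y * z) = P * Q * ((x * y * z) ^ 2 + (x * y + x * z + y * z)) ∧
      c * (x * y * z) = P * Q * ((x * y + x * z + y * z) * (x * y * z) + (x + y + z)) := by
  set l := x * y * z with hl'
  -- The roots of the quartic have product 1, so the fourth is `1 / l`. Subtracting `P * Q * (l * u
  -- - 1)` times the cubic from `l` times the quartic and dividing by `u` leaves a quadratic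
  -- vanishing at the three points.
  have key : ∀ u ∈ ({x, y, z} : Set ℂ),
      (P * Q * ((x + y + z) * l + 1) - a * l) * u ^ 2 +
        (c * l - P * Q * ((x * y + x * z + y * z) * l + (x + y + z))) * u +
        (P * Q * (l ^ 2 + (x * y + x * z + y * z)) - b * l) = 0 := by
    intro u hu
    have hu0 : u ≠ 0 := by
      rintro rfl
      rcases hu with rfl | rfl | rfl <;> simp [hl'] at hl
    have hr : (u - x) * (u - y) * (u - z) = 0 := by
      rcases hu with rfl | rfl | rfl <;> ring
    apply mul_left_cancel₀ hu0
    linear_combination l * h u hu - P * Q * (l * u - 1) * hr - P * Q * (l * u - 1) * hl'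
  obtain ⟨h1, h2, h3⟩ := quadratic_coeffs_eq_zero hxy hxz hyz (key x (by simp)) (key y (by simp))
    (key z (by simp))
  exact ⟨(sub_eq_zero.1 h1).symm, (sub_eq_zero.1 h3).symm, sub_eq_zero.1 h2⟩

theorem power_eq (S : EuclideanGeometry.Sphere ℂ) (X : ℂ) :
    (S.power X : ℂ) = (X - S.center) * conj (X - S.center) - (S.radius : ℂ) ^ 2 := by
  rw [EuclideanGeometry.Sphere.power, dist_eq_norm, Complex.mul_conj']
  push_cast
  rfl

theorem ninePointCircle_center_eq (T : Affine.Triangle ℝ ℂ) :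
    T.ninePointCircle.center = (T.points 0 + T.points 1 + T.points 2 - T.circumcenter) / 2 := by
  have h : T.centroid = (T.points 0 + T.points 1 + T.points 2) / 3 := by
    have hsum : ∑ i, T.points i = T.points 0 + T.points 1 + T.points 2 := Fin.sum_univ_three _
    have := T.centroid_vsub_eq (0 : ℂ)
    simp only [vsub_eq_sub, sub_zero, Complex.real_smul, hsum] at this
    rw [this]
    push_cast
    ring
  rw [Affine.Simplex.ninePointCircle_center, h]
  simp only [vsub_eq_sub, vadd_eq_add, Complex.real_smul]
  push_cast
  ring

theorem sq_sub_sq_ne_zero {p q : ℝ} (hpq : |p| ≠ |q|) : (p : ℂ) ^ 2 - q ^ 2 ≠ 0 := by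
  intro h
  refine hpq ?_
  rw [← sq_eq_sq_iff_abs_eq_abs]
  exact_mod_cast sub_eq_zero.1 h

/-- The circumcentre and the power of the origin for the triangles of the family. -/
theorem circumcircle_of_isBlaschkeFiber {p q : ℝ} {f g l : ℂ}
    {z : Fin 3 → ℂ} (h : IsBlaschkeFiber f g l z) {T : Affine.Triangle ℝ ℂ}
    (hT : ∀ i, T.points i = affineMap p q (z i)) :
    ((p : ℂ) ^ 2 - q ^ 2) * T.circumcenter =
        p * q * (p * (l + (conj f + conj g) + conj l * (f * g)) -
          q * (f + g + l * (conj f * conj g) + conj l)) ∧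
      T.circumcenter * conj T.circumcenter - (T.circumradius : ℂ) ^ 2 =
        p * q * (f * g + conj f * conj g + l * (conj f + conj g) + conj l * (f + g)) -
          p ^ 2 - q ^ 2 := by
  have hl : l * conj l = 1 := by rw [Complex.mul_conj', h.norm_param]; norm_num
  have hl0 : l ≠ 0 := left_ne_zero_of_mul_eq_one hl
  have h1 := h.sum
  have h2 := h.sum_mul
  have h3 := h.prod
  set O := T.circumcenter
  set K := O * conj O - (T.circumradius : ℂ) ^ 2 with hK
  -- The circumcircle equation at `affineMap p q u`, multiplied by `u²` with `conj u = 1 / u`.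
  have hz : ∀ i, (p : ℂ) * q * z i ^ 4 - (conj O * p + O * q) * z i ^ 3 +
      (p ^ 2 + q ^ 2 + K) * z i ^ 2 - (conj O * q + O * p) * z i + p * q = 0 := by
    intro i
    have hzi : z i * conj (z i) = 1 := by rw [Complex.mul_conj', h.norm_eq i]; norm_num
    have hd : (T.points i - O) * conj (T.points i - O) = (T.circumradius : ℂ) ^ 2 := by
      rw [Complex.mul_conj', ← dist_eq_norm, T.dist_circumcenter_eq_circumradius]
    rw [hT, affineMap] at hd
    simp only [map_sub, map_add, map_mul, Complex.conj_conj, Complex.conj_ofReal] at hd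
    rw [hK]
    generalize conj (z i) = w at *
    generalize z i = u at *
    linear_combination u ^ 2 * hd + (-(p ^ 2 + q ^ 2) * u ^ 2 - p * q * (u * w + 1) +
      u * conj O * q + u * O * p) * hzi
  obtain ⟨ha, hb, hc⟩ := circle_coeffs (h.injective.ne (show (0 : Fin 3) ≠ 1 by decide))
    (h.injective.ne (show (0 : Fin 3) ≠ 2 by decide))
    (h.injective.ne (show (1 : Fin 3) ≠ 2 by decide)) (by rwa [h3]) (by
      intro u hu
      rcases hu with rfl | rfl | rfl
      exacts [hz 0, hz 1, hz 2])
  rw [h1, h2, h3] at hc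
  rw [h1, h3] at ha
  rw [h2, h3] at hb
  constructor
  · apply mul_left_cancel₀ hl0
    linear_combination p * hb - q * ha - p * q * (p * f * g - q) * hl
  · apply mul_left_cancel₀ hl0
    linear_combination hc - p * q * (f + g) * hl

theorem circumsphere_power_eq {p q : ℝ} {f g l : ℂ} {z : Fin 3 → ℂ}
    (h : IsBlaschkeFiber f g l z) {T : Affine.Triangle ℝ ℂ}
    (hT : ∀ i, T.points i = affineMap p q (z i)) (X : ℂ) :
    ((p : ℂ) ^ 2 - q ^ 2) * T.circumsphere.power X =
      (((p : ℂ) ^ 2 - q ^ 2) * (X * conj X) -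
          p * q * (p * (f + g) - q * (conj f + conj g)) * X -
          p * q * (p * (conj f + conj g) - q * (f + g)) * conj X +
          ((p : ℂ) ^ 2 - q ^ 2) * (p * q * (f * g + conj f * conj g) - p ^ 2 - q ^ 2)) +
        l * (p * q * (((p : ℂ) ^ 2 - q ^ 2) * (conj f + conj g) -
          (p * (conj f * conj g) - q) * X - (p - q * (conj f * conj g)) * conj X)) +
        conj l * (p * q * (((p : ℂ) ^ 2 - q ^ 2) * (f + g) -
          (p - q * (f * g)) * X - (p * (f * g) - q) * conj X)) := by
  obtain ⟨hO, hK⟩ := circumcircle_of_isBlaschkeFiber h hT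
  have hO' := congrArg conj hO
  simp only [map_mul, map_sub, map_add, map_pow, Complex.conj_ofReal, Complex.conj_conj] at hO'
  rw [power_eq, Affine.Simplex.circumsphere_center, Affine.Simplex.circumsphere_radius, map_sub]
  linear_combination ((p : ℂ) ^ 2 - q ^ 2) * hK - X * hO' - conj X * hO

theorem ninePointCircle_power_eq {p q : ℝ} (hpq : |p| ≠ |q|) {f g l : ℂ} {z : Fin 3 → ℂ}
    (h : IsBlaschkeFiber f g l z) {T : Affine.Triangle ℝ ℂ}
    (hT : ∀ i, T.points i = affineMap p q (z i)) (X : ℂ) :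
    4 * ((p : ℂ) ^ 2 - q ^ 2) * T.ninePointCircle.power X =
      (4 * ((p : ℂ) ^ 2 - q ^ 2) * (X * conj X) -
          2 * (p ^ 3 * (conj f + conj g) - q ^ 3 * (f + g)) * X -
          2 * (p ^ 3 * (f + g) - q ^ 3 * (conj f + conj g)) * conj X +
          ((p : ℂ) ^ 2 - q ^ 2) * (p ^ 2 + q ^ 2) *
            ((f + g) * (conj f + conj g) + f * g * (conj f * conj g) - 1)) +
        l * (((p : ℂ) ^ 2 - q ^ 2) * (p ^ 2 + q ^ 2) * (conj f * conj g) * (conj f + conj g) -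
          2 * (q ^ 2 * (p - q * (conj f * conj g)) * X +
            p ^ 2 * (p * (conj f * conj g) - q) * conj X)) +
        conj l * (((p : ℂ) ^ 2 - q ^ 2) * (p ^ 2 + q ^ 2) * (f * g) * (f + g) -
          2 * (p ^ 2 * (p * (f * g) - q) * X + q ^ 2 * (p - q * (f * g)) * conj X)) := by
  obtain ⟨hO, hK⟩ := circumcircle_of_isBlaschkeFiber h hT
  have hl : l * conj l = 1 := by rw [Complex.mul_conj', h.norm_param]; norm_num
  have h1 := h.sum
  have h1' := congrArg conj h1
  have hO' := congrArg conj hO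
  simp only [map_mul, map_sub, map_add, map_pow, Complex.conj_ofReal, Complex.conj_conj] at hO' h1'
  have hW : T.points 0 + T.points 1 + T.points 2 =
      p * (f + g + l * (conj f * conj g)) + q * (conj f + conj g + conj l * (f * g)) := by
    simp only [hT, affineMap]
    linear_combination p * h1 + q * h1'
  have hΔ := sq_sub_sq_ne_zero hpq
  rw [power_eq, ninePointCircle_center_eq, Affine.Simplex.ninePointCircle_radius, hW]
  simp only [map_mul, map_sub, map_add, map_div₀, Complex.conj_ofReal, Complex.conj_conj,
    map_ofNat]
  push_cast
  set O := T.circumcenter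
  generalize conj O = O' at *
  generalize conj f = F at *
  generalize conj g = G at *
  generalize conj X = Y at *
  generalize conj l = k at *
  generalize (T.circumradius : ℂ) = R at *
  clear h h1 h1' hT hW
  generalize (p : ℂ) = p at *
  generalize (q : ℂ) = q at *
  -- The terms in `l²` and `conj l²` cancel, so the result is again affine in `l` and `conj l`.
  linear_combination (p ^ 2 - q ^ 2) * hK +
    (2 * X - (p * (f + g + l * (F * G)) + q * (F + G + k * (f * g)))) * hO' +
    (2 * Y - (p * (F + G + k * (f * g)) + q * (f + g + l * (F * G)))) * hO +
    (p ^ 2 - q ^ 2) * ((p ^ 2 + q ^ 2) * (f * g * (F * G)) - p * q * (f * g + F * G)) * hl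

/-! ### Points of constant power: existence and uniqueness. -/

theorem coeffs_eq_zero_of_const {a b c d : ℂ}
    (h : ∀ l : ℂ, ‖l‖ = 1 → a + l * b + conj l * c = d) : b = 0 ∧ c = 0 := by
  have h1 := h 1 (by simp)
  have h2 := h (-1) (by simp)
  have h3 := h Complex.I (by simp)
  have h4 := h (-Complex.I) (by simp)
  simp only [map_one, map_neg, Complex.conj_I] at h1 h2 h3 h4
  have h5 : b + c = 0 := by linear_combination (h1 - h2) / 2
  have h6 : b - c = 0 := by
    linear_combination -Complex.I * (h3 - h4) / 2 + (b - c) * Complex.I_sq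
  exact ⟨by linear_combination (h5 + h6) / 2, by linear_combination (h5 - h6) / 2⟩

theorem prod_sub_one_ne_zero {f g : ℂ} (hf : ‖f‖ < 1) (hg : ‖g‖ < 1) :
    f * g * (conj f * conj g) - 1 ≠ 0 := by
  intro h
  have h1 : ‖f * g * conj (f * g)‖ = 1 := by rw [map_mul, sub_eq_zero.1 h, norm_one]
  rw [norm_mul, RCLike.norm_conj, norm_mul] at h1
  have h2 : ‖f‖ * ‖g‖ < 1 := mul_lt_one_of_nonneg_of_lt_one_left (norm_nonneg _) hf hg.le
  nlinarith [norm_nonneg f, norm_nonneg g, mul_nonneg (norm_nonneg f) (norm_nonneg g)]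

theorem P3_eq (f g : ℂ) (p q : ℝ) :
    P3 f g p q = ((f * g * (conj f + conj g) - (f + g)) * p +
      (conj f * conj g * (f + g) - (conj f + conj g)) * q) / (f * g * (conj f * conj g) - 1) := by
  rw [P3, ← Complex.mul_conj', ← Complex.mul_conj', ← add_div,
    show f * conj f * (g * conj g) - 1 = f * g * (conj f * conj g) - 1 by ring]
  ring

theorem Pi3_eq (f g : ℂ) (p q : ℝ) :
    Pi3 f g p q = (g * conj g - 1) * (conj f * g - 1) * (f * conj g - 1) * (f * conj f - 1) *
      (p * q * (f * g + conj f * conj g) - p ^ 2 - q ^ 2) /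
        (f * g * (conj f * conj g) - 1) ^ 2 := by
  rw [Pi3, ← Complex.mul_conj', ← Complex.mul_conj',
    show f * conj f * (g * conj g) - 1 = f * g * (conj f * conj g) - 1 by ring]

theorem circumsphere_power_P3 {p q : ℝ} (hpq : |p| ≠ |q|) {f g l : ℂ} (hf : ‖f‖ < 1)
    (hg : ‖g‖ < 1) {z : Fin 3 → ℂ} (h : IsBlaschkeFiber f g l z) {T : Affine.Triangle ℝ ℂ}
    (hT : ∀ i, T.points i = affineMap p q (z i)) :
    (T.circumsphere.power (P3 f g p q) : ℂ) = Pi3 f g p q := by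
  have hΔ := sq_sub_sq_ne_zero hpq
  have hδ := prod_sub_one_ne_zero hf hg
  have hX := (eq_div_iff hδ).1 (P3_eq f g p q)
  have hY := congrArg conj hX
  have hP := (eq_div_iff (pow_ne_zero 2 hδ)).1 (Pi3_eq f g p q)
  simp only [map_mul, map_sub, map_add, Complex.conj_ofReal, Complex.conj_conj, map_one] at hY
  apply mul_left_cancel₀ hΔ
  apply mul_left_cancel₀ (pow_ne_zero 2 hδ)
  rw [circumsphere_power_eq h hT]
  generalize conj f = F at *
  generalize conj g = G at *
  generalize conj l = k at *
  generalize conj (P3 f g p q) = Y at *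
  generalize P3 f g p q = X at *
  generalize Pi3 f g p q = W at *
  clear h hT
  generalize (p : ℂ) = p at *
  generalize (q : ℂ) = q at *
  linear_combination ((p ^ 2 - q ^ 2) * Y * (f * g * (F * G) - 1) -
      p * q * (p * (f + g) - q * (F + G) + l * (p * (F * G) - q) + k * (p - q * (f * g))) *
        (f * g * (F * G) - 1)) * hX +
    ((p ^ 2 - q ^ 2) * ((f * g * (F + G) - (f + g)) * p + (F * G * (f + g) - (F + G)) * q) -
      p * q * (p * (F + G) - q * (f + g) + l * (p - q * (F * G)) + k * (p * (f * g) - q)) *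
        (f * g * (F * G) - 1)) * hY - (p ^ 2 - q ^ 2) * hP

theorem eq_P3_of_const {p q : ℝ} (hpq : |p| ≠ |q|) (hp : p ≠ 0) (hq : q ≠ 0) {f g : ℂ}
    (hf : ‖f‖ < 1) (hg : ‖g‖ < 1) {X : ℂ}
    (h1 : (p : ℂ) * q * (((p : ℂ) ^ 2 - q ^ 2) * (conj f + conj g) -
          (p * (conj f * conj g) - q) * X - (p - q * (conj f * conj g)) * conj X) = 0)
    (h2 : (p : ℂ) * q * (((p : ℂ) ^ 2 - q ^ 2) * (f + g) -
          (p - q * (f * g)) * X - (p * (f * g) - q) * conj X) = 0) :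
    X = P3 f g p q := by
  have hΔ := sq_sub_sq_ne_zero hpq
  have hδ := prod_sub_one_ne_zero hf hg
  have hpq0 : (p : ℂ) * q ≠ 0 := by simp [hp, hq]
  have e1 := (mul_eq_zero.1 h1).resolve_left hpq0
  have e2 := (mul_eq_zero.1 h2).resolve_left hpq0
  rw [P3_eq, eq_div_iff hδ]
  apply mul_left_cancel₀ hΔ
  -- Elimination of `conj X`; the determinant is `(p² - q²) (|f|² |g|² - 1)`.
  linear_combination (p - q * (conj f * conj g)) * e2 - (p * (f * g) - q) * e1

theorem P5Denom_eq (f g : ℂ) (p q : ℝ) :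
    P5Denom f g p q = 2 * (f * g * (conj f * conj g) * (p ^ 4 + q ^ 4 + p ^ 2 * q ^ 2) -
      (f * g + conj f * conj g) * p * q * (p ^ 2 + q ^ 2) + p ^ 2 * q ^ 2) := by
  rw [P5Denom, ← Complex.mul_conj', mul_assoc 2, ← Complex.mul_conj']
  ring

theorem gamma2_eq (f g : ℂ) (p q : ℝ) :
    gamma2 f g (conj f) (conj g) p q = P5Denom f g p q ^ 2 := by
  rw [gamma2, P5Denom_eq]
  ring

theorem conj_P5Denom (f g : ℂ) (p q : ℝ) : conj (P5Denom f g p q) = P5Denom f g p q := by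
  rw [P5Denom_eq]
  simp only [map_mul, map_sub, map_add, map_pow, Complex.conj_ofReal, Complex.conj_conj, map_ofNat]
  ring

theorem ninePointCircle_power_P5 {p q : ℝ} (hpq : |p| ≠ |q|) {f g l : ℂ}
    (hD : P5Denom f g p q ≠ 0) {z : Fin 3 → ℂ} (h : IsBlaschkeFiber f g l z)
    {T : Affine.Triangle ℝ ℂ} (hT : ∀ i, T.points i = affineMap p q (z i)) :
    (T.ninePointCircle.power (P5 f g p q) : ℂ) = Pi5 f g p q := by
  have hΔ := sq_sub_sq_ne_zero hpq
  have hX : P5 f g p q * P5Denom f g p q = _ := div_mul_cancel₀ _ hD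
  have hY := congrArg conj hX
  have hP : Pi5 f g p q * P5Denom f g p q ^ 2 = (p ^ 2 + q ^ 2) *
      (f * g * (conj f * conj g) - 1) * gamma1 f g (conj f) (conj g) p q := by
    rw [Pi5, gamma2_eq, ← Complex.mul_conj', map_mul]
    field_simp
  have hD2 := P5Denom_eq f g p q
  simp only [map_mul, map_sub, map_add, map_pow, Complex.conj_ofReal, Complex.conj_conj,
    conj_P5Denom] at hY
  apply mul_left_cancel₀ (mul_ne_zero (show (4 : ℂ) ≠ 0 by norm_num) hΔ)
  apply mul_left_cancel₀ (pow_ne_zero 2 hD)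
  rw [ninePointCircle_power_eq hpq h hT]
  generalize conj f = F at *
  generalize conj g = G at *
  generalize conj l = k at *
  generalize conj (P5 f g p q) = Y at *
  generalize P5 f g p q = X at *
  generalize Pi5 f g p q = W at *
  generalize P5Denom f g p q = D at *
  clear h hT hD
  generalize (p : ℂ) = p at *
  generalize (q : ℂ) = q at *
  set n := f * g * (f + g) * p ^ 2 * (F * G * p - q) + F * G * q ^ 2 * (F + G) * (f * g * q - p)
    with hn
  set n' := F * G * (F + G) * p ^ 2 * (f * g * p - q) + f * g * q ^ 2 * (f + g) * (F * G * q - p)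
    with hn'
  -- With `X = n (p² + q²) / D` and `Y = n' (p² + q²) / D`, `e1` and `e2` kill the coefficients of
  -- `l` and `conj l`, while `e0` evaluates the constant term.
  have e1 : D * ((p ^ 2 - q ^ 2) * (F * G) * (F + G)) =
      2 * (q ^ 2 * (p - q * (F * G)) * n + p ^ 2 * (p * (F * G) - q) * n') := by
    rw [hD2, hn, hn']
    ring
  have e2 : D * ((p ^ 2 - q ^ 2) * (f * g) * (f + g)) =
      2 * (p ^ 2 * (p * (f * g) - q) * n + q ^ 2 * (p - q * (f * g)) * n') := by
    rw [hD2, hn, hn']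
    ring
  have e0 : 4 * (p ^ 2 - q ^ 2) * (p ^ 2 + q ^ 2) * n * n' -
      D * (2 * (p ^ 3 * (F + G) - q ^ 3 * (f + g)) * n +
        2 * (p ^ 3 * (f + g) - q ^ 3 * (F + G)) * n') +
      D ^ 2 * ((p ^ 2 - q ^ 2) * ((f + g) * (F + G) + f * g * (F * G) - 1)) =
      4 * (p ^ 2 - q ^ 2) * (f * g * (F * G) - 1) * gamma1 f g F G p q := by
    rw [hD2, hn, hn', gamma1]
    ring
  linear_combination (4 * (p ^ 2 - q ^ 2) * Y * D -
      2 * (p ^ 3 * (F + G) - q ^ 3 * (f + g) + l * (q ^ 2 * (p - q * (F * G))) +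
        k * (p ^ 2 * (p * (f * g) - q))) * D) * hX +
    (4 * (p ^ 2 - q ^ 2) * (n * (p ^ 2 + q ^ 2)) -
      2 * (p ^ 3 * (f + g) - q ^ 3 * (F + G) + l * (p ^ 2 * (p * (F * G) - q)) +
        k * (q ^ 2 * (p - q * (f * g)))) * D) * hY - 4 * (p ^ 2 - q ^ 2) * hP +
    (p ^ 2 + q ^ 2) * (e0 + l * D * e1 + k * D * e2)

/-- The determinant of the system in `X` and `conj X` is, up to sign and a numerical factor, `(p² -
q²)` times `P5Denom`; this is where that denominator comes from. -/
theorem eq_P5_of_const {p q : ℝ} (hpq : |p| ≠ |q|) {f g : ℂ}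
    (hD : P5Denom f g p q ≠ 0) {X : ℂ}
    (h1 : ((p : ℂ) ^ 2 - q ^ 2) * (p ^ 2 + q ^ 2) * (conj f * conj g) * (conj f + conj g) -
          2 * (q ^ 2 * (p - q * (conj f * conj g)) * X +
            p ^ 2 * (p * (conj f * conj g) - q) * conj X) = 0)
    (h2 : ((p : ℂ) ^ 2 - q ^ 2) * (p ^ 2 + q ^ 2) * (f * g) * (f + g) -
          2 * (p ^ 2 * (p * (f * g) - q) * X + q ^ 2 * (p - q * (f * g)) * conj X) = 0) :
    X = P5 f g p q := by
  have hΔ := sq_sub_sq_ne_zero hpq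
  rw [P5, eq_div_iff hD, P5Denom_eq]
  apply mul_left_cancel₀ hΔ
  linear_combination q ^ 2 * (p - q * (f * g)) * h1 - p ^ 2 * (p * (conj f * conj g) - q) * h2

end PonceletPower

open PonceletPower in
theorem mainTheorem4 (p q : ℝ) (hpq : |p| ≠ |q|) (f g : ℂ) (L : ℝ)
    (hL : dist f g < L)
    (hnested : focalEllipse f g L ⊆ Metric.ball 0 1)
    (hfamily : (ponceletFamily p q f g L).Nonempty) :
    (∀ T ∈ ponceletFamily p q f g L, (T.circumsphere.power (P3 f g p q) : ℂ) = Pi3 f g p q) ∧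
    (p ≠ 0 → q ≠ 0 → ∀ X : ℂ,
      (∃ c : ℝ, ∀ T ∈ ponceletFamily p q f g L, T.circumsphere.power X = c) →
        X = P3 f g p q) ∧
    (P5Denom f g p q ≠ 0 →
      (∀ T ∈ ponceletFamily p q f g L,
        (T.ninePointCircle.power (P5 f g p q) : ℂ) = Pi5 f g p q) ∧
      ∀ X : ℂ,
        (∃ c : ℝ, ∀ T ∈ ponceletFamily p q f g L, T.ninePointCircle.power X = c) →
          X = P5 f g p q) := by
  have hf := norm_focus_lt_one hL hnested
  have hg : ‖g‖ < 1 := by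
    refine norm_focus_lt_one (dist_comm f g ▸ hL) (fun z hz => hnested ?_)
    have hz : dist z g + dist z f = L := hz
    exact (add_comm _ _).trans hz
  refine ⟨fun T hT => ?_, fun hp hq X ⟨c, hc⟩ => ?_, fun hD => ⟨fun T hT => ?_, fun X ⟨c, hc⟩ => ?_⟩⟩
  · obtain ⟨⟨l, z, hz, hTz⟩, -⟩ := exists_isBlaschkeFiber_of_mem hpq hL hT
    exact circumsphere_power_P3 hpq hf hg hz hTz
  -- The porism supplies a triangle for every unimodular `l`, so constancy over the family is
  -- constancy over the whole circle.
  · obtain ⟨h1, h2⟩ := coeffs_eq_zero_of_const fun l hl => by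
      obtain ⟨T, hT, z, hz, hTz⟩ := exists_mem_of_norm_eq_one hpq hL hf hg hfamily hl
      have := circumsphere_power_eq hz hTz X
      rw [hc T hT] at this
      exact this.symm
    exact eq_P3_of_const hpq hp hq hf hg h1 h2
  · obtain ⟨⟨l, z, hz, hTz⟩, -⟩ := exists_isBlaschkeFiber_of_mem hpq hL hT
    exact ninePointCircle_power_P5 hpq hD hz hTz
  · obtain ⟨h1, h2⟩ := coeffs_eq_zero_of_const fun l hl => by
      obtain ⟨T, hT, z, hz, hTz⟩ := exists_mem_of_norm_eq_one hpq hL hf hg hfamily hl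
      have := ninePointCircle_power_eq hpq hz hTz X
      rw [hc T hT] at this
      exact this.symm
    exact eq_P5_of_const hpq hD h1 h2
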